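/- Let $l:\mathbb{R}^m\to\mathbb{R}$ be twice continuously differentiable and strongly convex on every compact convex set (the modulus may depend on the set), let $A\in\mathbb{R}^{m\times n}$, and let $P:\mathbb{R}^n\to(-\infty,\infty]$ be a convex piecewise linear-quadratic function; that is, $P$ is proper, lower semicontinuous and convex, and $\operatorname{dom}P=\{x: P(x)<\infty\}$ is a union of finitely many polyhedra, on each of which $P$ has the form $P(x)=\frac12x^TMx+a^Tx+\gamma$ with $M$ a symmetric matrix, $a\in\mathbb{R}^n$ and $\gamma\in\mathbb{R}$. Put $$f(x)=l(Ax)+P(x),\qquad x\in\mathbb{R}^n.$$ If the set $\operatorname{Arg\,min} f$ of global minimizers of $f$ is nonempty and compact, then $f$ is a KL function with an exponent of $\frac12$; that is, $f$ is proper and lower semicontinuous, and for every $\bar x\in\mathbb{R}^n$ with $\partial f(\bar x)\neq\emptyset$ there are $c,\epsilon>0$ and $\nu\in(0,\infty]$ such that $$\operatorname{dist}(0,\partial f(x))\ \ge\ c\,\bigl(f(x)-f(\bar x)\bigr)^{1/2}$$ for all $x$ with $\|x-\bar x\|\le\epsilon$ and $f(\bar x)<f(x)<f(\bar x)+\nu$.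 Here $\|\cdot\|$ is the Euclidean norm and $\operatorname{dist}(0,\emptyset)=\infty$. For $x\in\operatorname{dom}f$, the limiting subdifferential $\partial f(x)$ is the set of limits $v=\lim_t v^t$ with $v^t\in\widehat\partial f(x^t)$, $x^t\to x$ and $f(x^t)\to f(x)$, where, for $x\in\operatorname{dom} f$, $$\widehat\partial f(x)=\Bigl\{v:\ \liminf_{z\to x,\,z\ne x}\frac{f(z)-f(x)-\langle v,z-x\rangle}{\|z-x\|}\ge0\Bigr\};$$ both sets are empty for $x\notin\operatorname{dom}f$. -/

import Mathlib

open Filter Topology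

namespace KL

/-- `ℝⁿ` with its Euclidean norm and inner product. -/
abbrev Rn (n : ℕ) : Type := EuclideanSpace ℝ (Fin n)

/-- The effective domain of an extended-real-valued function. -/
def dom {n : ℕ} (f : Rn n → EReal) : Set (Rn n) := {x | f x < ⊤}

/-- A function is proper if it never takes the value `-∞` and has nonempty domain. -/
def IsProper {n : ℕ} (f : Rn n → EReal) : Prop :=
  (∀ x, f x ≠ ⊥) ∧ (dom f).Nonempty

/-- Proper and closed (lower semicontinuous). -/
def IsProperClosed {n : ℕ} (f : Rn n → EReal) : Prop :=
  IsProper f ∧ LowerSemicontinuous f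

/-- Convexity of an extended-real-valued function: its epigraph is convex. -/
def IsConvexFun {n : ℕ} (f : Rn n → EReal) : Prop :=
  Convex ℝ {p : Rn n × ℝ | f p.1 ≤ (p.2 : EReal)}

/-- The regular subdifferential
`{v | liminf_{z → x, z ≠ x} (f z - f x - ⟪v, z - x⟫) / ‖z - x‖ ≥ 0}` for `x ∈ dom f`,
and `∅` for `x ∉ dom f`. -/
def regularSubdiff {n : ℕ} (f : Rn n → EReal) (x : Rn n) : Set (Rn n) :=
  {v | x ∈ dom f ∧
    0 ≤ liminf (fun z : Rn n =>
      (f z - f x - ((inner ℝ v (z - x) : ℝ) : EReal)) / ((‖z - x‖ : ℝ) : EReal)) (𝓝[≠] x)}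

/-- The limiting subdifferential; it is `∅` for `x ∉ dom f`. -/
def subdiff {n : ℕ} (f : Rn n → EReal) (x : Rn n) : Set (Rn n) :=
  {v | x ∈ dom f ∧ ∃ (xs vs : ℕ → Rn n),
    Tendsto xs atTop (𝓝 x) ∧ Tendsto (fun t => f (xs t)) atTop (𝓝 (f x)) ∧
    Tendsto vs atTop (𝓝 v) ∧ ∀ t, vs t ∈ regularSubdiff f (xs t)}

/-- The domain of the limiting subdifferential. -/
def domSubdiff {n : ℕ} (f : Rn n → EReal) : Set (Rn n) := {x | (subdiff f x).Nonempty}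

/-- The KL inequality at `xbar` with exponent `α`: there are `c, ε > 0` and `ν ∈ (0, ∞]` with
`dist(0, ∂f(x)) ≥ c (f(x) - f(xbar))^α` whenever `‖x - xbar‖ ≤ ε` and
`f(xbar) < f(x) < f(xbar) + ν`. The distance to the empty set is `∞`. -/
def HasKLExponentAt {n : ℕ} (f : Rn n → EReal) (α : ℝ) (xbar : Rn n) : Prop :=
  ∃ (c ε : ℝ) (ν : EReal), 0 < c ∧ 0 < ε ∧ 0 < ν ∧
    ∀ x : Rn n, ‖x - xbar‖ ≤ ε → f xbar < f x → f x < f xbar + ν →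
      ENNReal.ofReal (c * ((f x).toReal - (f xbar).toReal) ^ α) ≤
        Metric.infEDist 0 (subdiff f x)

/-- `f` is a KL function with an exponent of `α ∈ [0, 1)`: it is proper and closed and has the
KL property with exponent `α` at every point of `dom ∂f`. -/
def IsKLFunctionWithExponent {n : ℕ} (f : Rn n → EReal) (α : ℝ) : Prop :=
  IsProperClosed f ∧ 0 ≤ α ∧ α < 1 ∧ ∀ xbar ∈ domSubdiff f, HasKLExponentAt f α xbar

/-- A polyhedron: a finite intersection of closed half-spaces. -/
def IsPolyhedron {n : ℕ} (C : Set (Rn n)) : Prop :=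
  ∃ (p : ℕ) (b : Fin p → Rn n) (β : Fin p → ℝ), C = {x | ∀ j, inner ℝ (b j) x ≤ β j}

/-- Piecewise linear-quadratic: proper, closed, and `dom F` is a finite union of polyhedra, on
each of which `F x = ½ xᵀ M x + aᵀ x + γ` with `M` symmetric. -/
def IsPLQ {n : ℕ} (F : Rn n → EReal) : Prop :=
  IsProperClosed F ∧
  ∃ (k : ℕ) (C : Fin k → Set (Rn n)) (M : Fin k → Matrix (Fin n) (Fin n) ℝ)
    (a : Fin k → Rn n) (γ : Fin k → ℝ),
    (∀ i, IsPolyhedron (C i)) ∧ (∀ i, (M i).IsSymm) ∧ dom F = ⋃ i, C i ∧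
    ∀ i, ∀ x ∈ C i,
      F x = ((1 / 2 * inner ℝ x (Matrix.toEuclideanLin (M i) x) + inner ℝ (a i) x + γ i : ℝ) :
        EReal)

/-- The set of global minimizers. -/
def Argmin {n : ℕ} (f : Rn n → EReal) : Set (Rn n) := {x | ∀ y, f x ≤ f y}

/-- `l` is strongly convex on every compact convex set, the modulus depending on the set. -/
def StronglyConvexOnCompacts {m : ℕ} (l : Rn m → ℝ) : Prop :=
  ∀ K : Set (Rn m), IsCompact K → Convex ℝ K → ∃ σ : ℝ, 0 < σ ∧ StrongConvexOn K σ l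

end KL

/-! The function `f` is convex, so limiting subgradients obey the convex subgradient inequality.
Near a point that is not a minimizer, comparison with a strictly better point bounds subgradients
away from zero. At a minimizer `xbar`, write `D = f x - f xbar`. Quadratic growth `κ * ‖x - p‖ ^ 2 ≤
D` with `f p = f xbar`, combined with `D ≤ ‖v‖ * ‖x - p‖` for `v ∈ ∂f(x)`, gives `κ * D ≤ ‖v‖ ^ 2`.

Growth is proved on each polyhedral piece. If the piece contains `xbar`, put `w = x - xbar`; near
`xbar`, `D ≥ φ w + ½⟪w, Q w⟫ + (σ/2)‖A w‖²`, where `φ` is the linear part at `xbar` and `σ` a local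
modulus of `l`. On the tangent cone each term is nonnegative, and all three vanish on a polyhedral
cone. Hoffman's bound (`exists_hoffman_bound`) controls the distance to that cone by linear
residuals, whose squares are at most a constant times `D` (`exists_quadratic_growth_on_polyhedron`).
-/

namespace KL

/-! ### Hoffman's error bound for polyhedral cones -/

section Hoffman

variable {E F ι : Type*} [NormedAddCommGroup E] [InnerProductSpace ℝ E] [FiniteDimensional ℝ E]
  [NormedAddCommGroup F] [NormedSpace ℝ F]

/-- A vector in the polar of the cone `{z | ⟪b j, z⟫ ≤ 0, T z = 0}` is bounded by its violation of
the constraints that define the cone. -/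
theorem exists_norm_le_violation_of_mem_polar (b : ι → E) (T : E →L[ℝ] F) (J : Finset ι) :
    ∃ C : ℝ, 0 < C ∧ ∀ v : E,
      (∀ z : E, (∀ j ∈ J, inner ℝ (b j) z ≤ 0) → T z = 0 → inner ℝ v z ≤ 0) →
      ‖v‖ ≤ C * (∑ j ∈ J, max (inner ℝ (b j) v) 0 + ‖T v‖) := by
  set Φ : E → ℝ := fun v => ∑ j ∈ J, max (inner ℝ (b j) v) 0 + ‖T v‖ with hΦ
  have hΦc : Continuous Φ := by fun_prop
  have hΦ0 : ∀ v, 0 ≤ ∑ j ∈ J, max (inner ℝ (b j) v) 0 :=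
    fun v => Finset.sum_nonneg fun j _ => le_max_right _ _
  have hhom : ∀ (r : ℝ) (v : E), 0 ≤ r → Φ (r • v) = r * Φ v := by
    intro r v hr
    simp only [hΦ, map_smul, norm_smul, Real.norm_of_nonneg hr, inner_smul_right, mul_add,
      Finset.mul_sum]
    congr 1
    refine Finset.sum_congr rfl fun j _ => ?_
    rw [mul_max_of_nonneg _ _ hr, mul_zero]
  set N : Set E := {v | ∀ z : E, (∀ j ∈ J, inner ℝ (b j) z ≤ 0) → T z = 0 → inner ℝ v z ≤ 0}
    with hN
  have hNc : IsClosed N := by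
    simp only [hN, Set.ofPred_forall]
    exact isClosed_iInter fun z => isClosed_iInter fun _ => isClosed_iInter fun _ =>
      isClosed_le (by fun_prop) continuous_const
  have hcomp : IsCompact (Metric.sphere (0 : E) 1 ∩ N) := (isCompact_sphere 0 1).inter_right hNc
  have hunit : ∀ v ∈ N, v ≠ 0 → ‖v‖⁻¹ • v ∈ Metric.sphere (0 : E) 1 ∩ N := by
    intro v hv hv0
    refine ⟨by simp [norm_smul, hv0], fun z h1 h2 => ?_⟩
    rw [real_inner_smul_left]
    exact mul_nonpos_of_nonneg_of_nonpos (by positivity) (hv z h1 h2)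
  rcases (Metric.sphere (0 : E) 1 ∩ N).eq_empty_or_nonempty with he | hne
  · refine ⟨1, one_pos, fun v hv => ?_⟩
    have : v = 0 := by
      by_contra h
      simpa [he] using hunit v hv h
    subst this
    simp
  · obtain ⟨u, hu, hmin⟩ := hcomp.exists_isMinOn hne hΦc.continuousOn
    have hu1 : ‖u‖ = 1 := by simpa using hu.1
    -- If `Φ u = 0`, then `u` lies in the cone as well as in its polar, so `⟪u, u⟫ ≤ 0`, although
    -- `‖u‖ = 1`.
    have hpos : 0 < Φ u := by
      have h0 : 0 ≤ Φ u := add_nonneg (hΦ0 u) (norm_nonneg _)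
      refine lt_of_le_of_ne h0 fun h => ?_
      have h1 : ∑ j ∈ J, max (inner ℝ (b j) u) 0 = 0 := by
        have := hΦ0 u
        have := norm_nonneg (T u)
        simp only [hΦ] at h
        linarith
      have h2 : ‖T u‖ = 0 := by
        simp only [hΦ] at h
        linarith
      rw [Finset.sum_eq_zero_iff_of_nonneg fun j _ => le_max_right _ _] at h1
      have := hu.2 u (fun j hj => max_eq_right_iff.1 (h1 j hj)) (norm_eq_zero.1 h2)
      rw [real_inner_self_eq_norm_sq, hu1] at this
      norm_num at this
    refine ⟨(Φ u)⁻¹, inv_pos.2 hpos, fun v hv => ?_⟩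
    by_cases hv0 : v = 0
    · subst hv0
      simp [hΦ]
    · have h := hmin (hunit v hv hv0)
      simp only [Set.mem_ofPred_eq] at h
      rw [hhom _ _ (by positivity)] at h
      have hvp : 0 < ‖v‖ := norm_pos_iff.2 hv0
      change ‖v‖ ≤ (Φ u)⁻¹ * Φ v
      rw [inv_mul_eq_div, le_div_iff₀ hpos]
      rw [inv_mul_eq_div, le_div_iff₀ hvp] at h
      linarith

/-- **Hoffman's error bound** for a polyhedral cone `{p | ⟪b j, p⟫ ≤ 0, T p = 0}`. -/
theorem exists_hoffman_bound [Fintype ι] (b : ι → E) (T : E →L[ℝ] F) :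
    ∃ C : ℝ, 0 < C ∧ ∀ w : E, ∃ p : E, (∀ j, inner ℝ (b j) p ≤ 0) ∧ T p = 0 ∧
      ‖p‖ ≤ 2 * ‖w‖ ∧ ‖w - p‖ ≤ C * (∑ j, max (inner ℝ (b j) w) 0 + ‖T w‖) := by
  classical
  choose C hC hbd using exists_norm_le_violation_of_mem_polar b T
  -- The constraints active at the projection depend on `w`; summing over all index sets makes the
  -- constant uniform.
  refine ⟨∑ J : Finset ι, C J, Finset.sum_pos (fun J _ => hC J) ⟨∅, Finset.mem_univ _⟩,
    fun w => ?_⟩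
  set S : Set E := {p | (∀ j, inner ℝ (b j) p ≤ 0) ∧ T p = 0} with hS
  have hSc : IsClosed S := by
    simp only [hS, Set.ofPred_and, Set.ofPred_forall]
    exact (isClosed_iInter fun j => isClosed_le (by fun_prop) continuous_const).inter
      (isClosed_eq (by fun_prop) continuous_const)
  have h0S : (0 : E) ∈ S := by simp [hS]
  have hconv : Convex ℝ S := by
    intro x hx y hy s t hs ht hst
    refine ⟨fun j => ?_, by simp [hx.2, hy.2]⟩
    rw [inner_add_right, inner_smul_right, inner_smul_right]
    have := mul_nonpos_of_nonneg_of_nonpos hs (hx.1 j)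
    have := mul_nonpos_of_nonneg_of_nonpos ht (hy.1 j)
    linarith
  obtain ⟨p, hpS, hp⟩ := exists_norm_eq_iInf_of_complete_convex ⟨0, h0S⟩ hSc.isComplete hconv w
  have hproj := (norm_eq_iInf_iff_real_inner_le_zero hconv hpS).1 hp
  have hle : ‖w - p‖ ≤ ‖w‖ := by
    rw [hp]
    refine (ciInf_le ⟨0, ?_⟩ (⟨0, h0S⟩ : S)).trans (by simp)
    rintro _ ⟨q, rfl⟩
    exact norm_nonneg _
  refine ⟨p, hpS.1, hpS.2, ?_, ?_⟩
  · have := norm_sub_norm_le p w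
    rw [norm_sub_rev] at this
    linarith
  set J : Finset ι := Finset.univ.filter fun j => inner ℝ (b j) p = 0 with hJ
  -- The residual `w - p` is normal to the cone at its projection `p`, hence polar to the cone cut
  -- out by the constraints active at `p`. On these, `w` and `w - p` have the same violation.
  have key := hbd J (w - p) ?_
  · have h1 : ∑ j ∈ J, max (inner ℝ (b j) (w - p)) 0 ≤ ∑ j, max (inner ℝ (b j) w) 0 := by
      calc _ = ∑ j ∈ J, max (inner ℝ (b j) w) 0 := by
            refine Finset.sum_congr rfl fun j hj => ?_
            rw [inner_sub_right, (Finset.mem_filter.1 hj).2, sub_zero]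
        _ ≤ _ := Finset.sum_le_sum_of_subset_of_nonneg (Finset.subset_univ _)
            fun j _ _ => le_max_right _ _
    have h2 : T (w - p) = T w := by rw [map_sub, hpS.2, sub_zero]
    rw [h2] at key
    have h3 : C J ≤ ∑ J : Finset ι, C J :=
      Finset.single_le_sum (f := C) (fun J _ => (hC J).le) (Finset.mem_univ J)
    have h4 : 0 ≤ ∑ j, max (inner ℝ (b j) w) 0 := Finset.sum_nonneg fun j _ => le_max_right _ _
    calc _ ≤ _ := key
      _ ≤ C J * (∑ j, max (inner ℝ (b j) w) 0 + ‖T w‖) := by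
        have := (hC J).le
        gcongr
      _ ≤ _ := by gcongr
  · intro z hz hTz
    have hev : ∀ᶠ t : ℝ in 𝓝[>] 0, ∀ j, inner ℝ (b j) (p + t • z) ≤ 0 := by
      rw [eventually_all]
      intro j
      by_cases hj : inner ℝ (b j) p = 0
      · filter_upwards [self_mem_nhdsWithin] with t ht
        rw [inner_add_right, hj, inner_smul_right, zero_add]
        exact mul_nonpos_of_nonneg_of_nonpos (le_of_lt ht) (hz j (by simp [hJ, hj]))
      · have hlt : inner ℝ (b j) p < 0 := lt_of_le_of_ne (hpS.1 j) hj
        have hct : Tendsto (fun t : ℝ => inner ℝ (b j) (p + t • z)) (𝓝 0)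
            (𝓝 (inner ℝ (b j) (p + (0 : ℝ) • z))) :=
          Continuous.tendsto (by fun_prop) 0
        rw [zero_smul, add_zero] at hct
        exact ((hct.eventually_lt_const hlt).filter_mono nhdsWithin_le_nhds).mono
          fun t ht => ht.le
    obtain ⟨t, ht, ht0⟩ := (hev.and self_mem_nhdsWithin).exists
    have := hproj (p + t • z) ⟨ht, by simp [hpS.2, hTz]⟩
    rw [add_sub_cancel_left, inner_smul_right] at this
    exact nonpos_of_mul_nonpos_right this ht0

end Hoffman

/-- A positive symmetric bilinear form controls the operator that represents it. -/
theorem exists_sq_norm_le_mul_inner {E : Type*} [NormedAddCommGroup E] [InnerProductSpace ℝ E]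
    (T : E →L[ℝ] E) (hT : ∀ x y, inner ℝ (T x) y = inner ℝ x (T y))
    (hpos : ∀ x, 0 ≤ inner ℝ x (T x)) :
    ∃ c : ℝ, 0 < c ∧ ∀ x, ‖T x‖ ^ 2 ≤ c * inner ℝ x (T x) := by
  refine ⟨‖T‖ + 1, by positivity, fun x => ?_⟩
  set N := ‖T‖ + 1 with hN
  have hNp : 0 < N := by positivity
  -- Positivity at `N • x - T x` replaces a square root of `T`; the `+ 1` in `N` permits division
  -- when `T = 0`.
  have h := hpos (N • x - T x)
  have h1 : inner ℝ (N • x - T x) (T (N • x - T x)) =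
      N ^ 2 * inner ℝ x (T x) - 2 * N * ‖T x‖ ^ 2 + inner ℝ (T x) (T (T x)) := by
    rw [map_sub, map_smul, inner_sub_left, inner_sub_right, inner_sub_right,
      real_inner_smul_left, real_inner_smul_left, real_inner_smul_right, real_inner_smul_right,
      ← hT x (T x), real_inner_self_eq_norm_sq]
    ring
  have h2 : inner ℝ (T x) (T (T x)) ≤ N * ‖T x‖ ^ 2 := by
    calc _ ≤ ‖T x‖ * ‖T (T x)‖ := real_inner_le_norm _ _
      _ ≤ ‖T x‖ * (‖T‖ * ‖T x‖) := by gcongr; exact T.le_opNorm _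
      _ ≤ N * ‖T x‖ ^ 2 := by nlinarith [sq_nonneg ‖T x‖]
  have h3 : N * ‖T x‖ ^ 2 ≤ N * (N * inner ℝ x (T x)) := by nlinarith
  exact le_of_mul_le_mul_left h3 hNp

/-! ### Convex subgradients and the KL inequality -/

section Convex

variable {n : ℕ} {f : Rn n → EReal}

theorem IsProper.coe_toReal (hf : IsProper f) {x : Rn n} (hx : x ∈ dom f) :
    (((f x).toReal : ℝ) : EReal) = f x :=
  EReal.coe_toReal (ne_of_lt hx) (hf.1 x)

theorem IsConvexFun.apply_segment_le (hf : IsConvexFun f) {x y : Rn n} {a b t : ℝ}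
    (hx : f x ≤ a) (hy : f y ≤ b) (ht0 : 0 ≤ t) (ht1 : t ≤ 1) :
    f (x + t • (y - x)) ≤ ((a + t * (b - a) : ℝ) : EReal) := by
  have h := hf (x := (x, a)) hx (y := (y, b)) hy (sub_nonneg.2 ht1) ht0 (by ring)
  have h1 : (1 - t) • (x, a) + t • (y, b) = (x + t • (y - x), a + t * (b - a)) := by
    ext1
    · simp only [Prod.smul_mk, Prod.mk_add_mk]
      module
    · simp only [Prod.smul_mk, Prod.mk_add_mk, smul_eq_mul]
      ring
  rw [h1] at h
  exact h

/-- Regular subgradients of a proper convex function are subgradients in the convex sense. -/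
theorem add_inner_le_of_mem_regularSubdiff (hp : IsProper f) (hf : IsConvexFun f) {x v : Rn n}
    (hv : v ∈ regularSubdiff f x) {z : Rn n} (hz : z ∈ dom f) :
    (f x).toReal + inner ℝ v (z - x) ≤ (f z).toReal := by
  obtain ⟨hx, hlim⟩ := hv
  by_contra! hlt
  have hzx : z ≠ x := by
    rintro rfl
    simp at hlt
  have hd : 0 < ‖z - x‖ := norm_pos_iff.2 (sub_ne_zero.2 hzx)
  -- By convexity, the quotients at points of the segment from `x` towards `z` are at most `r < 0`,
  -- against the liminf condition.
  set r : ℝ := ((f z).toReal - (f x).toReal - inner ℝ v (z - x)) / ‖z - x‖ with hr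
  have hr0 : r < 0 := div_neg_of_neg_of_pos (by linarith) hd
  have hev := eventually_lt_of_lt_liminf (lt_of_lt_of_le (EReal.coe_neg'.2 hr0) hlim)
  have htend : Tendsto (fun t : ℝ => x + t • (z - x)) (𝓝[>] 0) (𝓝[≠] x) := by
    refine tendsto_nhdsWithin_iff.2 ⟨?_, ?_⟩
    · have : Tendsto (fun t : ℝ => x + t • (z - x)) (𝓝 0) (𝓝 (x + (0 : ℝ) • (z - x))) :=
        Continuous.tendsto (by fun_prop) 0
      rw [zero_smul, add_zero] at this
      exact this.mono_left nhdsWithin_le_nhds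
    · filter_upwards [self_mem_nhdsWithin] with t ht
      have ht' : t ≠ 0 := ne_of_gt ht
      simp [ht', sub_ne_zero.2 hzx]
  have hlt1 : ∀ᶠ t : ℝ in 𝓝[>] 0, t < 1 :=
    (eventually_lt_nhds one_pos).filter_mono nhdsWithin_le_nhds
  obtain ⟨t, ⟨ht, ht1⟩, ht0⟩ := (((htend.eventually hev).and hlt1).and self_mem_nhdsWithin).exists
  have ht0 : 0 < t := ht0
  have hseg := hf.apply_segment_le (hp.coe_toReal hx).ge (hp.coe_toReal hz).ge ht0.le ht1.le
  have hsd : x + t • (z - x) ∈ dom f := lt_of_le_of_lt hseg (EReal.coe_lt_top _)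
  rw [← hp.coe_toReal hsd] at hseg ht
  rw [← hp.coe_toReal hx] at ht
  rw [← EReal.coe_sub, ← EReal.coe_sub, ← EReal.coe_div, EReal.coe_lt_coe_iff] at ht
  rw [EReal.coe_le_coe_iff] at hseg
  rw [add_sub_cancel_left, inner_smul_right, norm_smul, Real.norm_of_nonneg ht0.le,
    lt_div_iff₀ (by positivity), hr] at ht
  have : ((f z).toReal - (f x).toReal - inner ℝ v (z - x)) / ‖z - x‖ * (t * ‖z - x‖) =
      t * ((f z).toReal - (f x).toReal - inner ℝ v (z - x)) := by
    field_simp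
  rw [this] at ht
  nlinarith

/-- Limiting subgradients of a proper convex function are subgradients in the convex sense. -/
theorem add_inner_le_of_mem_subdiff (hp : IsProper f) (hf : IsConvexFun f) {x v : Rn n}
    (hv : v ∈ subdiff f x) {z : Rn n} (hz : z ∈ dom f) :
    (f x).toReal + inner ℝ v (z - x) ≤ (f z).toReal := by
  obtain ⟨hx, xs, vs, hxs, hfxs, hvs, hreg⟩ := hv
  have h1 : Tendsto (fun t => (f (xs t)).toReal) atTop (𝓝 (f x).toReal) :=
    (EReal.tendsto_toReal (ne_of_lt hx) (hp.1 x)).comp hfxs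
  exact le_of_tendsto (h1.add (hvs.inner (tendsto_const_nhds.sub hxs)))
    (Eventually.of_forall fun t => add_inner_le_of_mem_regularSubdiff hp hf (hreg t) hz)

/-- At a point that is not a global minimizer, every exponent in `[0, 1)` works; here `1 / 2`. -/
theorem hasKLExponentAt_of_notMem_argmin (hp : IsProper f) (hf : IsConvexFun f) {xbar : Rn n}
    (hx : xbar ∈ dom f) (hmin : xbar ∉ Argmin f) : HasKLExponentAt f (1 / 2) xbar := by
  obtain ⟨z, hz⟩ : ∃ z, f z < f xbar := by
    simpa [Argmin] using hmin
  have hzd : z ∈ dom f := hz.trans hx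
  have hz' : (f z).toReal < (f xbar).toReal := by
    rwa [← hp.coe_toReal hzd, ← hp.coe_toReal hx, EReal.coe_lt_coe_iff] at hz
  -- Radius `1` gives `‖z - x‖ ≤ ‖z - xbar‖ + 1`, and `ν = 1` keeps the power of the gap at most
  -- `1`.
  refine ⟨((f xbar).toReal - (f z).toReal) / (‖z - xbar‖ + 1), 1, 1,
    div_pos (sub_pos.2 hz') (by positivity), one_pos, one_pos, fun x hxε hlt hltν => ?_⟩
  refine Metric.le_infEDist.2 fun v hv => ?_
  have hxd : x ∈ dom f := hv.1
  rw [edist_dist, dist_zero_left]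
  refine ENNReal.ofReal_le_ofReal ?_
  rw [← hp.coe_toReal hxd, ← hp.coe_toReal hx] at hlt hltν
  rw [← EReal.coe_one, ← EReal.coe_add, EReal.coe_lt_coe_iff] at hltν
  rw [EReal.coe_lt_coe_iff] at hlt
  have h1 : ((f x).toReal - (f xbar).toReal) ^ (1 / 2 : ℝ) ≤ 1 :=
    Real.rpow_le_one (by linarith) (by linarith) (by norm_num)
  have hsub := add_inner_le_of_mem_subdiff hp hf hv hzd
  have h2 : -inner ℝ v (z - x) ≤ ‖v‖ * ‖z - x‖ :=
    (neg_le_abs _).trans (abs_real_inner_le_norm _ _)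
  have h3 : ‖z - x‖ ≤ ‖z - xbar‖ + 1 := by
    have := norm_sub_le_norm_sub_add_norm_sub z xbar x
    rw [norm_sub_rev xbar x] at this
    linarith
  have h4 : ‖v‖ * ‖z - x‖ ≤ ‖v‖ * (‖z - xbar‖ + 1) := by gcongr
  calc _ ≤ ((f xbar).toReal - (f z).toReal) / (‖z - xbar‖ + 1) * 1 := by
        have := sub_pos.2 hz'
        gcongr
    _ ≤ ‖v‖ := by
        rw [mul_one, div_le_iff₀ (by positivity)]
        linarith

/-- Local quadratic growth of a convex function implies the KL property with exponent `1 / 2`. -/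
theorem hasKLExponentAt_of_quadratic_growth (hp : IsProper f) (hf : IsConvexFun f) {xbar : Rn n}
    (hx : xbar ∈ dom f) {κ ε : ℝ} (hκ : 0 < κ) (hε : 0 < ε)
    (hgrowth : ∀ x ∈ dom f, ‖x - xbar‖ ≤ ε → ∃ p, f p = f xbar ∧
      κ * ‖x - p‖ ^ 2 ≤ (f x).toReal - (f xbar).toReal) :
    HasKLExponentAt f (1 / 2) xbar := by
  refine ⟨√κ, ε, 1, Real.sqrt_pos.2 hκ, hε, one_pos, fun x hxε hlt _ => ?_⟩
  refine Metric.le_infEDist.2 fun v hv => ?_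
  have hxd : x ∈ dom f := hv.1
  rw [edist_dist, dist_zero_left]
  refine ENNReal.ofReal_le_ofReal ?_
  obtain ⟨p, hpx, hgr⟩ := hgrowth x hxd hxε
  have hpd : p ∈ dom f := by
    change f p < ⊤
    rw [hpx]
    exact hx
  rw [← hp.coe_toReal hxd, ← hp.coe_toReal hx, EReal.coe_lt_coe_iff] at hlt
  have hsub := add_inner_le_of_mem_subdiff hp hf hv hpd
  rw [hpx] at hsub
  have h2 : -inner ℝ v (p - x) ≤ ‖v‖ * ‖x - p‖ := by
    rw [norm_sub_rev]
    exact (neg_le_abs _).trans (abs_real_inner_le_norm _ _)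
  set D := (f x).toReal - (f xbar).toReal with hD
  have hDpos : 0 < D := sub_pos.2 hlt
  have hDle : D ≤ ‖v‖ * ‖x - p‖ := by linarith
  rw [← Real.sqrt_eq_rpow, ← Real.sqrt_mul hκ.le]
  refine Real.sqrt_le_iff.2 ⟨norm_nonneg _, ?_⟩
  have h3 : D * D ≤ (‖v‖ * ‖x - p‖) * (‖v‖ * ‖x - p‖) :=
    mul_self_le_mul_self hDpos.le hDle
  have h4 : ‖v‖ ^ 2 * (κ * ‖x - p‖ ^ 2) ≤ ‖v‖ ^ 2 * D := by gcongr
  have h5 : κ * D * D ≤ ‖v‖ ^ 2 * D := by nlinarith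
  exact le_of_mul_le_mul_right h5 hDpos

end Convex

/-! ### Quadratic growth on a polyhedron -/

section Growth

variable {E F : Type*} [NormedAddCommGroup E] [InnerProductSpace ℝ E]
  [NormedAddCommGroup F] [NormedSpace ℝ F]

/-- Divide the strong convexity inequality on the segment by `t` and let `t → 0⁺`. -/
theorem StrongConvexOn.add_fderiv_add_sq_le {K : Set F} {σ : ℝ} {l : F → ℝ}
    (hl : StrongConvexOn K σ l) {y₀ y : F} (hd : DifferentiableAt ℝ l y₀) (hy₀ : y₀ ∈ K)
    (hy : y ∈ K) :
    l y₀ + fderiv ℝ l y₀ (y - y₀) + σ / 2 * ‖y - y₀‖ ^ 2 ≤ l y := by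
  have hs := (hd.hasFDerivAt.hasLineDerivAt (y - y₀)).tendsto_slope_zero_right
  have hr : Tendsto (fun t : ℝ => l y - l y₀ - (1 - t) * (σ / 2 * ‖y - y₀‖ ^ 2)) (𝓝[>] 0)
      (𝓝 (l y - l y₀ - (1 - 0) * (σ / 2 * ‖y - y₀‖ ^ 2))) :=
    (Continuous.tendsto (by fun_prop) 0).mono_left nhdsWithin_le_nhds
  have hlt1 : ∀ᶠ t : ℝ in 𝓝[>] 0, t < 1 :=
    (eventually_lt_nhds one_pos).filter_mono nhdsWithin_le_nhds
  have := le_of_tendsto_of_tendsto hs hr ?_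
  · linarith
  filter_upwards [hlt1, self_mem_nhdsWithin] with t ht1 ht0
  have ht0 : 0 < t := ht0
  have h := hl.2 hy₀ hy (sub_nonneg.2 ht1.le) ht0.le (by ring)
  have h1 : (1 - t) • y₀ + t • y = y₀ + t • (y - y₀) := by module
  rw [h1, norm_sub_rev] at h
  simp only [smul_eq_mul] at h ⊢
  rw [inv_mul_le_iff₀ ht0]
  linarith

/-- Quadratic growth on a polyhedron of a sum of a quadratic function, convex and minimal at
`xbar` on the polyhedron, and the square of a seminorm. -/
theorem exists_quadratic_growth_on_polyhedron [FiniteDimensional ℝ E] {ι : Type*} [Fintype ι]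
    (b : ι → E) (β : ι → ℝ) {C : Set E} (hC : C = {x | ∀ j, inner ℝ (b j) x ≤ β j})
    {xbar : E} (hxbar : xbar ∈ C) (Q : E →L[ℝ] E) (hQ : ∀ x y, inner ℝ (Q x) y = inner ℝ x (Q y))
    (φ : E →L[ℝ] ℝ) (T : E →L[ℝ] F) {σ : ℝ} (hσ : 0 < σ)
    (hmin : ∀ x ∈ C, 0 ≤ φ (x - xbar) + 1 / 2 * inner ℝ (x - xbar) (Q (x - xbar)))
    (hconv : ∀ x ∈ C, ∀ y ∈ C, 0 ≤ inner ℝ (x - y) (Q (x - y))) :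
    ∃ κ ε : ℝ, 0 < κ ∧ 0 < ε ∧ ∀ x ∈ C, ‖x - xbar‖ ≤ ε → ∃ p ∈ C,
      φ (p - xbar) + 1 / 2 * inner ℝ (p - xbar) (Q (p - xbar)) = 0 ∧ T (p - xbar) = 0 ∧
      κ * ‖x - p‖ ^ 2 ≤ φ (x - xbar) + 1 / 2 * inner ℝ (x - xbar) (Q (x - xbar)) +
        σ / 2 * ‖T (x - xbar)‖ ^ 2 := by
  classical
  have hbar : ∀ j, inner ℝ (b j) xbar ≤ β j := by rwa [hC] at hxbar
  set I := {j // inner ℝ (b j) xbar = β j}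
  -- `K` is the tangent cone of `C` at `xbar`; the two sets `C - xbar` and `K` agree near `0`.
  set K : Set E := {w | ∀ j : I, inner ℝ (b j) w ≤ 0} with hK
  have hCK : ∀ x ∈ C, x - xbar ∈ K := by
    intro x hx j
    rw [hC] at hx
    rw [inner_sub_right, j.2]
    linarith [hx j]
  have hKC : ∀ᶠ w in 𝓝 (0 : E), w ∈ K → xbar + w ∈ C := by
    have h : ∀ᶠ w in 𝓝 (0 : E), ∀ j, w ∈ K → inner ℝ (b j) (xbar + w) ≤ β j := by
      rw [eventually_all]
      intro j
      by_cases hj : inner ℝ (b j) xbar = β j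
      · refine Eventually.of_forall fun w hw => ?_
        rw [inner_add_right, hj]
        linarith [hw ⟨j, hj⟩]
      · have hlt : inner ℝ (b j) xbar < β j := lt_of_le_of_ne (hbar j) hj
        have ht : Tendsto (fun w : E => inner ℝ (b j) (xbar + w)) (𝓝 0)
            (𝓝 (inner ℝ (b j) (xbar + 0))) := Continuous.tendsto (by fun_prop) 0
        rw [add_zero] at ht
        exact (ht.eventually_lt_const hlt).mono fun w hw _ => hw.le
    filter_upwards [h] with w hw hwK
    rw [hC]
    exact fun j => hw j hwK
  have hKsmul : ∀ w ∈ K, ∀ t : ℝ, 0 ≤ t → t • w ∈ K := by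
    intro w hw t ht j
    rw [inner_smul_right]
    exact mul_nonpos_of_nonneg_of_nonpos ht (hw j)
  have hKadd : ∀ w ∈ K, ∀ w' ∈ K, w + w' ∈ K := by
    intro w hw w' hw' j
    rw [inner_add_right]
    linarith [hw j, hw' j]
  have hray : ∀ w ∈ K, ∀ᶠ t : ℝ in 𝓝[>] 0, xbar + t • w ∈ C := by
    intro w hw
    have ht : Tendsto (fun t : ℝ => t • w) (𝓝[>] 0) (𝓝 0) := by
      have : Tendsto (fun t : ℝ => t • w) (𝓝 0) (𝓝 ((0 : ℝ) • w)) :=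
        Continuous.tendsto (by fun_prop) 0
      rw [zero_smul] at this
      exact this.mono_left nhdsWithin_le_nhds
    filter_upwards [ht.eventually hKC, self_mem_nhdsWithin] with t h ht0
    exact h (hKsmul w hw t (le_of_lt ht0))
  have hdiff : ∀ w ∈ K, ∀ w' ∈ K, 0 ≤ inner ℝ (w - w') (Q (w - w')) := by
    intro w hw w' hw'
    obtain ⟨t, ⟨h1, h2⟩, ht0⟩ :=
      (((hray w hw).and (hray w' hw')).and self_mem_nhdsWithin).exists
    have ht0 : 0 < t := ht0
    have h := hconv _ h1 _ h2
    rw [add_sub_add_left_eq_sub, ← smul_sub, map_smul, inner_smul_right,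
      real_inner_smul_left, ← mul_assoc] at h
    exact nonneg_of_mul_nonneg_right h (by positivity)
  have hspan : ∀ u ∈ Submodule.span ℝ K, ∃ w ∈ K, ∃ w' ∈ K, u = w - w' := by
    have h0 : (0 : E) ∈ K := fun j => by simp
    intro u hu
    induction hu using Submodule.span_induction with
    | mem w hw => exact ⟨w, hw, 0, h0, by simp⟩
    | zero => exact ⟨0, h0, 0, h0, by simp⟩
    | add x y _ _ hx hy =>
      obtain ⟨w, hw, w', hw', rfl⟩ := hx
      obtain ⟨z, hz, z', hz', rfl⟩ := hy
      exact ⟨w + z, hKadd _ hw _ hz, w' + z', hKadd _ hw' _ hz', by abel⟩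
    | smul a x _ hx =>
      obtain ⟨w, hw, w', hw', rfl⟩ := hx
      rcases le_total 0 a with ha | ha
      · exact ⟨a • w, hKsmul _ hw _ ha, a • w', hKsmul _ hw' _ ha, smul_sub _ _ _⟩
      · exact ⟨(-a) • w', hKsmul _ hw' _ (by linarith), (-a) • w, hKsmul _ hw _ (by linarith),
          by module⟩
  set L := Submodule.span ℝ K with hL
  set pr : E →L[ℝ] E := L.starProjection with hpr
  -- `Q` is known to be nonnegative only on `L = K - K`. Its compression `S` to `L` is nonnegative
  -- everywhere and has the same quadratic form on `K`.
  set S : E →L[ℝ] E := pr.comp (Q.comp pr) with hS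
  have hprsymm : ∀ x y, inner ℝ (pr x) y = inner ℝ x (pr y) :=
    fun x y => L.inner_starProjection_left_eq_right x y
  have hSinner : ∀ x y, inner ℝ x (S y) = inner ℝ (pr x) (Q (pr y)) :=
    fun x y => (hprsymm x _).symm
  have hSsymm : ∀ x y, inner ℝ (S x) y = inner ℝ x (S y) := by
    intro x y
    rw [hSinner, ← hQ, ← hprsymm]
    exact hprsymm _ _ |>.trans (hprsymm _ _).symm
  have hSpos : ∀ x, 0 ≤ inner ℝ x (S x) := by
    intro x
    rw [hSinner]
    obtain ⟨w, hw, w', hw', h⟩ := hspan (pr x) (L.starProjection_apply_mem x)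
    rw [h]
    exact hdiff w hw w' hw'
  have hSK : ∀ w ∈ K, inner ℝ w (S w) = inner ℝ w (Q w) := by
    intro w hw
    have : pr w = w := Submodule.starProjection_eq_self_iff.2 (Submodule.subset_span hw)
    rw [hSinner, this]
  have hφK : ∀ w ∈ K, 0 ≤ φ w := by
    intro w hw
    have ht : Tendsto (fun t : ℝ => φ w + t * (1 / 2 * inner ℝ w (Q w))) (𝓝[>] 0)
        (𝓝 (φ w + 0 * (1 / 2 * inner ℝ w (Q w)))) :=
      (Continuous.tendsto (by fun_prop) 0).mono_left nhdsWithin_le_nhds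
    rw [zero_mul, add_zero] at ht
    refine ge_of_tendsto ht ?_
    filter_upwards [hray w hw, self_mem_nhdsWithin] with t h ht0
    have ht0 : 0 < t := ht0
    have h := hmin _ h
    rw [add_sub_cancel_left, map_smul, map_smul, inner_smul_right, real_inner_smul_left,
      smul_eq_mul] at h
    have : 0 ≤ t * (φ w + t * (1 / 2 * inner ℝ w (Q w))) := by linarith
    exact nonneg_of_mul_nonneg_right this ht0
  obtain ⟨c, hc, hSc⟩ := exists_sq_norm_le_mul_inner S hSsymm hSpos
  obtain ⟨H, hH, hHoff⟩ := exists_hoffman_bound (fun j : I => b j) (φ.prod (S.prod T))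
  obtain ⟨δ, hδ, hδC⟩ := Metric.eventually_nhds_iff.1 hKC
  -- The summands come from `(φ w)² ≤ ‖φ‖ * φ w`, `‖S w‖² ≤ c * ⟪w, S w⟫` and `‖T w‖² = (2/σ) *
  -- ((σ/2) * ‖T w‖²)`.
  set R : ℝ := ‖φ‖ + 2 * c + 2 / σ with hR
  have hRpos : 0 < R := by positivity
  -- With `δ / 3`, the bound `‖p‖ ≤ 2 * ‖w‖ < δ` puts `xbar + p` in `C`; the `1` ensures `φ w ≤
  -- ‖φ‖`.
  refine ⟨1 / (H ^ 2 * R), min (δ / 3) 1, by positivity, by positivity, fun x hx hxε => ?_⟩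
  set w := x - xbar with hw
  have hwK : w ∈ K := hCK x hx
  obtain ⟨p, hpK, hpT, hpw, hwp⟩ := hHoff w
  have hpφ : φ p = 0 := congrArg Prod.fst hpT
  have hpS : S p = 0 := congrArg (fun q => q.2.1) hpT
  have hpT' : T p = 0 := congrArg (fun q => q.2.2) hpT
  refine ⟨xbar + p, hδC ?_ hpK, ?_, by rwa [add_sub_cancel_left], ?_⟩
  · rw [dist_zero_right]
    have := hxε.trans (min_le_left _ _)
    linarith
  · rw [add_sub_cancel_left, hpφ, ← hSK p hpK, hpS, inner_zero_right]
    simp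
  have hxp : x - (xbar + p) = w - p := by rw [hw]; abel
  rw [hxp]
  have hφ0 := hφK w hwK
  have hq0 : 0 ≤ inner ℝ w (Q w) := by
    rw [← hSK w hwK]
    exact hSpos w
  have ht0 : 0 ≤ σ / 2 * ‖T w‖ ^ 2 := by positivity
  set D := φ w + 1 / 2 * inner ℝ w (Q w) + σ / 2 * ‖T w‖ ^ 2 with hD
  have hD0 : 0 ≤ D := by positivity
  have hsum : ∑ j : I, max (inner ℝ (b j) w) 0 = 0 :=
    Finset.sum_eq_zero fun j _ => max_eq_right (hwK j)
  rw [hsum, zero_add] at hwp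
  have hφw : φ w ≤ ‖φ‖ := by
    calc φ w ≤ ‖φ w‖ := Real.le_norm_self _
      _ ≤ ‖φ‖ * ‖w‖ := φ.le_opNorm w
      _ ≤ ‖φ‖ * 1 := by
        gcongr
        exact hxε.trans (min_le_right _ _)
      _ = ‖φ‖ := mul_one _
  have hσ2 : 0 < 2 / σ := by positivity
  have hRD : ∀ r d : ℝ, 0 ≤ r → r ≤ R → d ≤ D → r * d ≤ R * D := by
    intro r d hr hrR hd
    calc r * d ≤ r * D := by gcongr
      _ ≤ R * D := by gcongr
  have hnorm : ‖(φ.prod (S.prod T)) w‖ ≤ √(R * D) := by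
    refine max_le ?_ (max_le ?_ ?_)
    · refine Real.abs_le_sqrt ?_
      calc φ w ^ 2 = φ w * φ w := sq _
        _ ≤ ‖φ‖ * φ w := by gcongr
        _ ≤ R * D := hRD _ _ (norm_nonneg _) (by linarith) (by linarith)
    · refine Real.le_sqrt_of_sq_le ((hSc w).trans ?_)
      rw [hSK w hwK]
      calc c * inner ℝ w (Q w) = 2 * c * (1 / 2 * inner ℝ w (Q w)) := by ring
        _ ≤ R * D := hRD _ _ (by positivity) (by linarith [norm_nonneg φ]) (by linarith)
    · refine Real.le_sqrt_of_sq_le ?_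
      calc ‖T w‖ ^ 2 = 2 / σ * (σ / 2 * ‖T w‖ ^ 2) := by field_simp
        _ ≤ R * D := hRD _ _ (by positivity) (by linarith [norm_nonneg φ]) (by linarith)
  have h1 : ‖w - p‖ ^ 2 ≤ H ^ 2 * (R * D) := by
    calc ‖w - p‖ ^ 2 ≤ (H * √(R * D)) ^ 2 := by
          gcongr
          exact hwp.trans (by gcongr)
      _ = H ^ 2 * (R * D) := by rw [mul_pow, Real.sq_sqrt (by positivity)]
  rw [one_div, inv_mul_le_iff₀ (by positivity)]
  linarith

end Growth

/-! ### Auxiliary facts: extended reals, polyhedra, convexity from local moduli -/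

theorem coe_add_le_coe_iff {r a : ℝ} {e : EReal} :
    (r : EReal) + e ≤ a ↔ e ≤ ((a - r : ℝ) : EReal) := by
  induction e with
  | bot => simp
  | coe e =>
    rw [← EReal.coe_add, EReal.coe_le_coe_iff, EReal.coe_le_coe_iff]
    exact (le_sub_iff_add_le').symm
  | top =>
    rw [EReal.coe_add_top, top_le_iff, top_le_iff]
    simp only [EReal.coe_ne_top]

theorem exists_pos_le_of_finite {ι : Type*} [Finite ι] {κ : ι → ℝ} (hκ : ∀ i, 0 < κ i) :
    ∃ c : ℝ, 0 < c ∧ ∀ i, c ≤ κ i := by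
  have h : ∀ᶠ c : ℝ in 𝓝[>] 0, ∀ i, c ≤ κ i := by
    rw [eventually_all]
    exact fun i => (eventually_le_nhds (hκ i)).filter_mono nhdsWithin_le_nhds
  obtain ⟨c, h1, h2⟩ := (h.and self_mem_nhdsWithin).exists
  exact ⟨c, h2, h1⟩

theorem IsPolyhedron.isClosed {n : ℕ} {C : Set (Rn n)} (hC : IsPolyhedron C) : IsClosed C := by
  obtain ⟨p, b, β, rfl⟩ := hC
  simp only [Set.ofPred_forall]
  exact isClosed_iInter fun j => isClosed_le (by fun_prop) continuous_const

theorem IsPolyhedron.convex {n : ℕ} {C : Set (Rn n)} (hC : IsPolyhedron C) : Convex ℝ C := by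
  obtain ⟨p, b, β, rfl⟩ := hC
  intro x hx y hy s t hs ht hst j
  rw [inner_add_right, inner_smul_right, inner_smul_right]
  have h1 := mul_le_mul_of_nonneg_left (hx j) hs
  have h2 := mul_le_mul_of_nonneg_left (hy j) ht
  have h3 : s * β j + t * β j = β j := by rw [← add_mul, hst, one_mul]
  linarith

theorem StronglyConvexOnCompacts.convexOn {m : ℕ} {l : Rn m → ℝ}
    (hl : StronglyConvexOnCompacts l) : ConvexOn ℝ Set.univ l := by
  refine ⟨convex_univ, fun x _ y _ s t hs ht hst => ?_⟩
  have hK : IsCompact (segment ℝ x y) := by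
    rw [segment_eq_image_lineMap]
    exact isCompact_Icc.image AffineMap.lineMap_continuous
  obtain ⟨σ, hσ, h⟩ := hl _ hK (convex_segment x y)
  exact (h.convexOn fun r => by positivity).2 (left_mem_segment ℝ x y) (right_mem_segment ℝ x y)
    hs ht hst

/-! ### The composite function `l ∘ A + P` -/

section Composite

variable {n m : ℕ} {A : Rn n →L[ℝ] Rn m} {l : Rn m → ℝ} {P f : Rn n → EReal}

theorem dom_eq_of_eq_coe_add (hf : ∀ x, f x = ((l (A x) : ℝ) : EReal) + P x) :
    dom f = dom P := by
  ext x
  simp only [dom, Set.mem_ofPred_eq, hf x]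
  induction P x with
  | bot => simp
  | coe e => simp [← EReal.coe_add]
  | top => simp

theorem isProperClosed_of_eq_coe_add (hl : Continuous l) (hP : IsProperClosed P)
    (hf : ∀ x, f x = ((l (A x) : ℝ) : EReal) + P x) : IsProperClosed f := by
  refine ⟨⟨fun x => ?_, by rw [dom_eq_of_eq_coe_add hf]; exact hP.1.2⟩, ?_⟩
  · rw [hf, Ne, EReal.add_eq_bot_iff]
    simp [hP.1.1 x]
  · have hc : Continuous fun x => ((l (A x) : ℝ) : EReal) :=
      continuous_coe_real_ereal.comp (hl.comp A.continuous)
    rw [funext hf]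
    exact hc.lowerSemicontinuous.add' hP.2 fun x =>
      EReal.continuousAt_add (.inl (EReal.coe_ne_top _)) (.inl (EReal.coe_ne_bot _))

theorem isConvexFun_of_eq_coe_add (hl : ConvexOn ℝ Set.univ l) (hP : IsConvexFun P)
    (hf : ∀ x, f x = ((l (A x) : ℝ) : EReal) + P x) : IsConvexFun f := by
  rintro ⟨x, a⟩ hx ⟨y, b⟩ hy s t hs ht hst
  simp only [Set.mem_ofPred_eq, hf, coe_add_le_coe_iff, Prod.smul_mk, Prod.mk_add_mk] at hx hy ⊢
  have h := hP (x := (x, a - l (A x))) hx (y := (y, b - l (A y))) hy hs ht hst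
  simp only [Set.mem_ofPred_eq, Prod.smul_mk, Prod.mk_add_mk] at h
  refine h.trans (EReal.coe_le_coe_iff.2 ?_)
  have hlA := hl.2 (Set.mem_univ (A x)) (Set.mem_univ (A y)) hs ht hst
  rw [map_add, map_smul, map_smul]
  simp only [smul_eq_mul] at hlA ⊢
  linarith

theorem toReal_of_eq_coe_add (hP : IsProper P)
    (hf : ∀ x, f x = ((l (A x) : ℝ) : EReal) + P x) {x : Rn n} (hx : x ∈ dom P) :
    (f x).toReal = l (A x) + (P x).toReal := by
  rw [hf, ← hP.coe_toReal hx, ← EReal.coe_add, EReal.toReal_coe, EReal.toReal_coe]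

/-- First-order optimality condition at a minimizer of `l ∘ A + P`. -/
theorem fderiv_add_sub_nonneg_of_mem_argmin (hP : IsProper P) (hPc : IsConvexFun P)
    (hf : ∀ x, f x = ((l (A x) : ℝ) : EReal) + P x) {xbar : Rn n} (hxbar : xbar ∈ dom P)
    (hd : DifferentiableAt ℝ l (A xbar)) (hmin : xbar ∈ Argmin f) {x : Rn n} (hx : x ∈ dom P) :
    0 ≤ fderiv ℝ l (A xbar) (A (x - xbar)) + ((P x).toReal - (P xbar).toReal) := by
  have hs := (hd.hasFDerivAt.hasLineDerivAt (A (x - xbar))).tendsto_slope_zero_right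
  have hlt1 : ∀ᶠ t : ℝ in 𝓝[>] 0, t < 1 :=
    (eventually_lt_nhds one_pos).filter_mono nhdsWithin_le_nhds
  have := ge_of_tendsto (b := -((P x).toReal - (P xbar).toReal)) hs ?_
  · linarith
  filter_upwards [hlt1, self_mem_nhdsWithin] with t ht1 ht0
  have ht0 : 0 < t := ht0
  have hseg := hPc.apply_segment_le (hP.coe_toReal hxbar).ge (hP.coe_toReal hx).ge ht0.le ht1.le
  have hsd : xbar + t • (x - xbar) ∈ dom P := lt_of_le_of_lt hseg (EReal.coe_lt_top _)
  have hle := hmin (xbar + t • (x - xbar))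
  rw [hf, hf, ← hP.coe_toReal hsd, ← hP.coe_toReal hxbar, ← EReal.coe_add, ← EReal.coe_add,
    EReal.coe_le_coe_iff, map_add, map_smul] at hle
  rw [← hP.coe_toReal hsd, EReal.coe_le_coe_iff] at hseg
  rw [smul_eq_mul, le_inv_mul_iff₀ ht0]
  linarith

/-- This is the exact second-order Taylor expansion at `y`. -/
theorem quadratic_sub_eq {Q : Rn n →L[ℝ] Rn n} (hQ : ∀ x y, inner ℝ (Q x) y = inner ℝ x (Q y))
    (a x y : Rn n) (γ : ℝ) :
    (1 / 2 * inner ℝ x (Q x) + inner ℝ a x + γ) - (1 / 2 * inner ℝ y (Q y) + inner ℝ a y + γ) =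
      inner ℝ (Q y + a) (x - y) + 1 / 2 * inner ℝ (x - y) (Q (x - y)) := by
  simp only [map_sub, inner_sub_left, inner_sub_right, inner_add_left]
  rw [hQ y x, hQ y y, ← hQ x y, real_inner_comm y (Q x), ← hQ y x]
  have : inner ℝ (Q y) x = inner ℝ y (Q x) := hQ y x
  have h2 : inner ℝ (Q x) y = inner ℝ y (Q x) := real_inner_comm _ _
  linarith

theorem exists_quadratic_growth_on_piece (hl : Differentiable ℝ l)
    (hlc : StronglyConvexOnCompacts l) (hP : IsProper P) (hPc : IsConvexFun P)
    (hf : ∀ x, f x = ((l (A x) : ℝ) : EReal) + P x) {C : Set (Rn n)} (hC : IsPolyhedron C)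
    (hCd : C ⊆ dom P) {Q : Rn n →L[ℝ] Rn n} (hQ : ∀ x y, inner ℝ (Q x) y = inner ℝ x (Q y))
    {a : Rn n} {γ : ℝ}
    (hPC : ∀ x ∈ C, P x = ((1 / 2 * inner ℝ x (Q x) + inner ℝ a x + γ : ℝ) : EReal))
    {xbar : Rn n} (hmin : xbar ∈ Argmin f) :
    ∃ κ ε : ℝ, 0 < κ ∧ 0 < ε ∧ ∀ x ∈ C, ‖x - xbar‖ ≤ ε → ∃ p, f p = f xbar ∧
      κ * ‖x - p‖ ^ 2 ≤ (f x).toReal - (f xbar).toReal := by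
  by_cases hxbar : xbar ∈ C
  swap
  -- A closed piece missing `xbar` also misses a ball around it, so the claim is vacuous.
  · obtain ⟨ε, hε, h⟩ := Metric.mem_nhds_iff.1 (hC.isClosed.isOpen_compl.mem_nhds hxbar)
    refine ⟨1, ε / 2, one_pos, by positivity, fun x hx hxε => absurd hx (h ?_)⟩
    rw [Metric.mem_ball, dist_eq_norm]
    linarith
  have hPr : ∀ x ∈ C, (P x).toReal = 1 / 2 * inner ℝ x (Q x) + inner ℝ a x + γ := by
    intro x hx
    rw [hPC x hx, EReal.toReal_coe]
  have hPsub : ∀ x ∈ C, ∀ y ∈ C, (P x).toReal - (P y).toReal =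
      inner ℝ (Q y + a) (x - y) + 1 / 2 * inner ℝ (x - y) (Q (x - y)) := by
    intro x hx y hy
    rw [hPr x hx, hPr y hy, quadratic_sub_eq hQ]
  set g := fderiv ℝ l (A xbar) with hg
  set φ : Rn n →L[ℝ] ℝ := g.comp A + innerSL ℝ (Q xbar + a) with hφ
  have hφa : ∀ w, φ w = g (A w) + inner ℝ (Q xbar + a) w := fun w => rfl
  -- This ball contains `A x` whenever `‖x - xbar‖ ≤ 1`.
  obtain ⟨σ, hσ, hsc⟩ := hlc (Metric.closedBall (A xbar) ‖A‖) (isCompact_closedBall _ _)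
    (convex_closedBall _ _)
  have hconv : ∀ x ∈ C, ∀ y ∈ C, 0 ≤ inner ℝ (x - y) (Q (x - y)) := by
    -- Expand `P` at the midpoint: in the midpoint convexity inequality the linear terms cancel,
    -- leaving the quadratic form at `x - y`.
    intro x hx y hy
    have hz : x + (1 / 2 : ℝ) • (y - x) ∈ C :=
      hC.convex.add_smul_sub_mem hx hy ⟨by norm_num, by norm_num⟩
    have hseg := hPc.apply_segment_le (hP.coe_toReal (hCd hx)).ge (hP.coe_toReal (hCd hy)).ge
      (t := 1 / 2) (by norm_num) (by norm_num)
    rw [← hP.coe_toReal (hCd hz), EReal.coe_le_coe_iff] at hseg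
    have h1 := hPsub x hx _ hz
    have h2 := hPsub y hy _ hz
    have e1 : x - (x + (1 / 2 : ℝ) • (y - x)) = (1 / 2 : ℝ) • (x - y) := by module
    have e2 : y - (x + (1 / 2 : ℝ) • (y - x)) = (-(1 / 2) : ℝ) • (x - y) := by module
    rw [e1, map_smul, inner_smul_right, inner_smul_right, real_inner_smul_left] at h1
    rw [e2, map_smul, inner_smul_right, inner_smul_right, real_inner_smul_left] at h2
    linarith
  have hnn : ∀ x ∈ C, 0 ≤ φ (x - xbar) + 1 / 2 * inner ℝ (x - xbar) (Q (x - xbar)) := by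
    intro x hx
    have := fderiv_add_sub_nonneg_of_mem_argmin hP hPc hf (hCd hxbar) (hl _) hmin (hCd hx)
    rw [hPsub x hx _ hxbar] at this
    rw [hφa]
    linarith
  obtain ⟨p, b, β, hCe⟩ := id hC
  obtain ⟨κ, ε, hκ, hε, H⟩ :=
    exists_quadratic_growth_on_polyhedron b β hCe hxbar Q hQ φ A hσ hnn hconv
  refine ⟨κ, min ε 1, hκ, by positivity, fun x hx hxε => ?_⟩
  obtain ⟨q, hqC, hq0, hqA, hq⟩ := H x hx (hxε.trans (min_le_left _ _))
  refine ⟨q, ?_, hq.trans ?_⟩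
  · have h1 : A q = A xbar := by rwa [map_sub, sub_eq_zero] at hqA
    have h2 := hPsub q hqC xbar hxbar
    rw [hφa, hqA, map_zero] at hq0
    have h3 : (P q).toReal = (P xbar).toReal := by linarith
    rw [hf, hf, h1, ← hP.coe_toReal (hCd hqC), h3, hP.coe_toReal (hCd hxbar)]
  · have hball : A x ∈ Metric.closedBall (A xbar) ‖A‖ := by
      rw [Metric.mem_closedBall, dist_eq_norm, ← map_sub]
      calc _ ≤ ‖A‖ * ‖x - xbar‖ := A.le_opNorm _
        _ ≤ ‖A‖ * 1 := by
          gcongr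
          exact hxε.trans (min_le_right _ _)
        _ = ‖A‖ := mul_one _
    have h1 := StrongConvexOn.add_fderiv_add_sq_le hsc (hl _)
      (Metric.mem_closedBall_self (norm_nonneg A)) hball
    rw [← map_sub] at h1
    rw [toReal_of_eq_coe_add hP hf (hCd hx), toReal_of_eq_coe_add hP hf (hCd hxbar), hφa]
    have h2 := hPsub x hx xbar hxbar
    linarith

end Composite

theorem inner_toEuclideanLin_eq_of_isSymm {n : ℕ} {M : Matrix (Fin n) (Fin n) ℝ} (hM : M.IsSymm)
    (x y : Rn n) :
    inner ℝ (Matrix.toEuclideanLin M x) y = inner ℝ x (Matrix.toEuclideanLin M y) := by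
  have h : M.IsHermitian := by
    rw [Matrix.IsHermitian, Matrix.conjTranspose_eq_transpose_of_trivial]
    exact hM
  exact Matrix.isSymmetric_toEuclideanLin_iff.2 h x y

end KL

/-! ### Assembly over the finitely many pieces -/

theorem mainTheorem11 {n m : ℕ} (A : Matrix (Fin m) (Fin n) ℝ)
    (l : KL.Rn m → ℝ) (P f : KL.Rn n → EReal)
    (hl : ContDiff ℝ 2 l) (hl_conv : KL.StronglyConvexOnCompacts l)
    (hP : KL.IsPLQ P) (hP_conv : KL.IsConvexFun P)
    (hf : ∀ x, f x = ((l (Matrix.toEuclideanLin A x) : ℝ) : EReal) + P x)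
    (hmin : (KL.Argmin f).Nonempty) (hmin_compact : IsCompact (KL.Argmin f)) :
    KL.IsKLFunctionWithExponent f (1 / 2) := by
  obtain ⟨hPpc, k, C, M, a, γ, hC, hM, hdom, hPC⟩ := hP
  set B : KL.Rn n →L[ℝ] KL.Rn m := (Matrix.toEuclideanLin A).toContinuousLinearMap
  have hfB : ∀ x, f x = ((l (B x) : ℝ) : EReal) + P x := hf
  have hfpc := KL.isProperClosed_of_eq_coe_add hl.continuous hPpc hfB
  have hfc := KL.isConvexFun_of_eq_coe_add hl_conv.convexOn hP_conv hfB
  refine ⟨hfpc, by norm_num, by norm_num, fun xbar ⟨v, hv⟩ => ?_⟩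
  have hxbar : xbar ∈ KL.dom f := hv.1
  by_cases hx : xbar ∈ KL.Argmin f
  swap
  · exact KL.hasKLExponentAt_of_notMem_argmin hfpc.1 hfc hxbar hx
  have hpiece := fun i => KL.exists_quadratic_growth_on_piece (hl.differentiable (by norm_num))
    hl_conv hPpc.1 hP_conv hfB (hC i) (hdom ▸ Set.subset_iUnion C i)
    (Q := (Matrix.toEuclideanLin (M i)).toContinuousLinearMap)
    (KL.inner_toEuclideanLin_eq_of_isSymm (hM i)) (hPC i) hx
  choose κ ε hκ hε H using hpiece
  obtain ⟨κ', hκ', hκle⟩ := KL.exists_pos_le_of_finite hκ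
  obtain ⟨ε', hε', hεle⟩ := KL.exists_pos_le_of_finite hε
  refine KL.hasKLExponentAt_of_quadratic_growth hfpc.1 hfc hxbar hκ' hε' fun x hxd hxε => ?_
  rw [KL.dom_eq_of_eq_coe_add hfB, hdom] at hxd
  obtain ⟨i, hi⟩ := Set.mem_iUnion.1 hxd
  obtain ⟨p, hp, hle⟩ := H i x hi (hxε.trans (hεle i))
  refine ⟨p, hp, le_trans ?_ hle⟩
  gcongr
  exact hκle i
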